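/- Let $E$ be an elliptic curve over $\mathbb{Q}$ given by a Weierstrass equation $y^2+a_1xy+a_3y=x^3+a_2x^2+a_4x+a_6$, let $N$ be its conductor, and let $f$ be the normalized newform of weight $2$ on $\Gamma_0(N)$ associated to $E$. For $\tau\in\mathcal{H}^*=\mathcal{H}\cup\mathbb{Q}\cup\{i\infty\}$ put $$\gamma(\tau)=\int_{i\infty}^{\tau}2\pi i f(z)\,dz .$$ Assume that $E$ is optimal with Manin constant $1$, that is, if $L$ denotes the period lattice of $E$ with respect to the differential $dx/(2y+a_1x+a_3)$, then $\gamma$ induces a map $X_0(N)\to\mathbb{C}/L$, and every map $X_0(N)\to\mathbb{C}/L'$ induced by a nonzero multiple of $\gamma$, for a lattice $L'\subset\mathbb{C}$, factors through it. Let $\wp$ be the Weierstrass function of $L$, let $b_2=a_1^2+4a_2$, and define $x:\mathcal{H}^*\to\mathbb{C}\cup\{\infty\}$ by $$x(\tau)=\wp(\gamma(\tau))-\frac{b_2}{12},$$ so that $x(\tau)=\infty$ exactly when $\gamma(\tau)\in L$. Suppose that $N=4m$ for a positive integer $m$ and that $\gamma\left(\frac{2}{N}\right)\in L$. Then $$x\left(\frac{\tau}{2m\tau+1}\right)=x(\tau)\qquad\text{for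 all }\tau\in\mathcal{H}^*,$$ where at the cusps $\tau\mapsto\tau/(2m\tau+1)$ is the Möbius transformation of $\mathbb{Q}\cup\{i\infty\}$, so that $i\infty\mapsto\frac{1}{2m}$ and $-\frac{1}{2m}\mapsto i\infty$. -/

import Mathlib

open UpperHalfPlane MeasureTheory CongruenceSubgroup
open scoped MatrixGroups ModularForm

noncomputable section

namespace ModularParam

/-! ### Newforms of weight two on `Γ₀(N)` -/

/-- The function `τ ↦ f (d τ)` on the upper half-plane, for a positive integer `d`. -/
def dilate (d : ℕ) (f : ℍ → ℂ) (τ : ℍ) : ℂ :=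
  f (ofComplex ((d : ℂ) * τ))

/-- The Petersson product of weight two at level `Γ₀(N)`: the integral of
`conj (f τ) * g τ * (im τ) ^ 2` against `dx dy / y ^ 2` over the fundamental domain
`⋃ M 𝒟` of `Γ₀(N)`, where `𝒟` is the standard fundamental domain of `SL(2, ℤ)` and `M` runs
through representatives of the (finitely many) right cosets `Γ₀(N) M` in `SL(2, ℤ)`.
(The inverses of representatives of left cosets represent the right cosets.) -/
def peterssonInner (N : ℕ) (f g : ℍ → ℂ) : ℂ :=
  ∑ᶠ c : SL(2, ℤ) ⧸ Gamma0 N, ∫ τ in ModularGroup.fd, petersson 2 f g ((c.out)⁻¹ • τ)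

/-- `f` lies in the new subspace of `S₂(Γ₀(N))`: it is orthogonal to all oldforms `g (d τ)` with
`g ∈ S₂(Γ₀(M))`, `M` a proper divisor of `N` and `d` a divisor of `N / M`. -/
def IsNew {N : ℕ} (f : CuspForm (Gamma0 N) 2) : Prop :=
  ∀ M d : ℕ, M ≠ N → d * M ∣ N → ∀ g : CuspForm (Gamma0 M) 2,
    peterssonInner N f (dilate d g) = 0

/-- The Hecke operator `T_p` (for `p ∤ N`), respectively `U_p` (for `p ∣ N`), in weight two
and level `Γ₀(N)`. -/
def hecke (N p : ℕ) (f : ℍ → ℂ) (τ : ℍ) : ℂ :=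
  (1 / (p : ℂ)) * ∑ b ∈ Finset.range p, f (ofComplex (((τ : ℂ) + b) / p)) +
    if p ∣ N then 0 else (p : ℂ) * dilate p f τ

/-- A normalized newform of weight two on `Γ₀(N)`: a cusp form in the new subspace which is an
eigenform of all Hecke operators and has first Fourier coefficient `1`. -/
structure IsNewform {N : ℕ} (f : CuspForm (Gamma0 N) 2) : Prop where
  new : IsNew f
  eigen : ∀ p : ℕ, p.Prime → ∃ a : ℂ, ∀ τ : ℍ, hecke N p f τ = a * f τ
  normalized : (qExpansion 1 f).coeff 1 = 1

/-- `f = ∑ aₙ qⁿ` is associated to the elliptic curve `W` over `ℚ`: the `aₙ` are the coefficients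
of the Hasse-Weil `L`-function of `W`. -/
def IsAssociated {N : ℕ} (f : CuspForm (Gamma0 N) 2) (W : WeierstrassCurve ℚ) : Prop :=
  ∀ n : ℕ, (qExpansion 1 f).coeff n = (W.LFunction n : ℂ)

/-! ### The extended upper half-plane and the Eichler integral -/

/-- The extended upper half-plane `ℍ ∪ ℚ ∪ {i∞}`. -/
inductive HStar : Type
  | point (τ : ℍ) : HStar
  | cusp (c : OnePoint ℚ) : HStar

/-- The action of `SL(2, ℤ)` on the extended upper half-plane by Möbius transformations. -/
def HStar.moebius (g : SL(2, ℤ)) : HStar → HStar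
  | .point τ => .point (g • τ)
  | .cusp c => .cusp (Matrix.SpecialLinearGroup.mapGL ℚ g • c)

/-- The integral of `2πi f(z) dz` from `i∞` down to `z₀` along the vertical half-line
`z₀ + i t`, `t > 0`. -/
def verticalIntegral (f : ℍ → ℂ) (z₀ : ℂ) : ℂ :=
  -∫ t in Set.Ioi (0 : ℝ),
    2 * Real.pi * Complex.I * f (ofComplex (z₀ + t * Complex.I)) * Complex.I

/-- The Eichler integral `γ(τ) = ∫_{i∞}^τ 2πi f(z) dz`, for `τ` in the extended upper
half-plane. -/
def eichler (f : ℍ → ℂ) : HStar → ℂ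
  | .point τ => verticalIntegral f τ
  | .cusp none => 0
  | .cusp (some r) => verticalIntegral f (r : ℂ)

/-! ### Period lattices and modular parametrizations -/

/-- `L` is (a basis of) the period lattice of the elliptic curve `W` over `ℚ`, with respect to the
invariant differential `dx / (2y + a₁x + a₃)`: the map
`z ↦ (℘(z) - b₂/12, (℘'(z) - a₁ (℘(z) - b₂/12) - a₃)/2)`, under which this differential pulls back
to `dz`, sends `ℂ / L` to `W`. -/
def IsPeriodLattice (W : WeierstrassCurve ℚ) (L : PeriodPair) : Prop :=
  ∀ z : ℂ, z ∉ L.lattice →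
    (W.map (algebraMap ℚ ℂ)).toAffine.Equation
      (L.weierstrassP z - (W.b₂ : ℂ) / 12)
      ((L.derivWeierstrassP z - (W.a₁ : ℂ) * (L.weierstrassP z - (W.b₂ : ℂ) / 12)
        - (W.a₃ : ℂ)) / 2)

/-- The map `τ ↦ c γ(τ)` induces a nonconstant map `X₀(N) → ℂ / L` (which sends the cusp `i∞` to
the origin and pulls `dz` back to `c · 2πi f(τ) dτ`). -/
def IsParametrization {N : ℕ} (f : CuspForm (Gamma0 N) 2) (L : PeriodPair) (c : ℂ) : Prop :=
  c ≠ 0 ∧ ∀ M ∈ Gamma0 N, ∀ τ : ℍ,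
    c * (eichler f (.point (M • τ)) - eichler f (.point τ)) ∈ L.lattice

/-- The parametrization `c γ : X₀(N) → ℂ / L` is optimal: every parametrization
`c' γ : X₀(N) → ℂ / L'` factors through it (by multiplication with `c' / c`). -/
def IsOptimal {N : ℕ} (f : CuspForm (Gamma0 N) 2) (L : PeriodPair) (c : ℂ) : Prop :=
  IsParametrization f L c ∧
    ∀ (L' : PeriodPair) (c' : ℂ), IsParametrization f L' c' →
      ∀ l ∈ L.lattice, c' / c * l ∈ L'.lattice

open Classical in
/-- The function `x(τ) = ℘(γ(τ)) - b₂/12` on the extended upper half-plane, with values in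
`ℂ ∪ {∞}`; the value is `∞` exactly at the poles of `℘ ∘ γ`. -/
def xCoord (W : WeierstrassCurve ℚ) (L : PeriodPair) (f : ℍ → ℂ) (τ : HStar) : OnePoint ℂ :=
  if eichler f τ ∈ L.lattice then OnePoint.infty
  else ((L.weierstrassP (eichler f τ) - (W.b₂ : ℂ) / 12 : ℂ) : OnePoint ℂ)

/-- The matrix with rows `(1, 0)` and `(2m, 1)`, which acts by `τ ↦ τ / (2mτ + 1)`. -/
def wMat (m : ℕ) : SL(2, ℤ) :=
  ⟨!![1, 0; 2 * (m : ℤ), 1], by simp [Matrix.det_fin_two]⟩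

theorem coe_wMat_smul (m : ℕ) (τ : ℍ) :
    ((wMat m • τ : ℍ) : ℂ) = (τ : ℂ) / (2 * m * (τ : ℂ) + 1) := by
  rw [UpperHalfPlane.specialLinearGroup_apply]
  simp [wMat]

theorem mapGL_wMat_apply (m : ℕ) (i j : Fin 2) :
    (Matrix.SpecialLinearGroup.mapGL ℚ (wMat m)) i j =
      (((!![1, 0; 2 * (m : ℤ), 1] : Matrix (Fin 2) (Fin 2) ℤ) i j : ℤ) : ℚ) :=
  rfl

theorem wMat_smul_cusp (m : ℕ) (r : ℚ) :
    HStar.moebius (wMat m) (.cusp (r : OnePoint ℚ)) =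
      .cusp (if 2 * m * r + 1 = 0 then OnePoint.infty
        else ((r / (2 * m * r + 1) : ℚ) : OnePoint ℚ)) := by
  simp only [HStar.moebius, OnePoint.smul_some_eq_ite, mapGL_wMat_apply]
  simp

theorem wMat_smul_infty (m : ℕ) (hm : m ≠ 0) :
    HStar.moebius (wMat m) (.cusp OnePoint.infty) =
      .cusp ((1 / (2 * m) : ℚ) : OnePoint ℚ) := by
  simp only [HStar.moebius, OnePoint.smul_infty_eq_ite, mapGL_wMat_apply]
  simp [hm]

end ModularParam

end

/-!
As `f` is new, it is orthogonal to every cusp form on `Γ₀(2m)`. Its trace to `Γ₀(2m)` is therefore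
orthogonal to itself, hence zero. Since `[Γ₀(2m) : Γ₀(4m)] = 2` and `w = wMat m` represents the
nontrivial coset, this trace is `f + f ∣ w`, so that `f ∣ w = -f`. Integrating
`2πi (f ∣ w)(z) dz = w^*(2πi f(z) dz)` from `i∞` gives `γ(w τ) = γ(1/2m) - γ(τ)`; as `γ(1/2m) ∈ L`
and `℘` is even and `L`-periodic, `x ∘ w = x`.
-/

noncomputable section

namespace ModularParam

open Filter Topology
open scoped Manifold
open Matrix.SpecialLinearGroup (mapGL mapGL_injective)

/-! ### Traces and Petersson products -/

instance : (volume : Measure ℍ).IsOpenPosMeasure := by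
  have : (volume.comap UpperHalfPlane.coe : Measure ℍ).IsOpenPosMeasure :=
    .comap _ isOpenEmbedding_coe
  refine (withDensity_absolutelyContinuous' ?_ (.of_forall fun τ ↦ ?_) :
    (volume.comap UpperHalfPlane.coe : Measure ℍ) ≪ volume).isOpenPosMeasure
  · refine Continuous.aemeasurable
      (ENNReal.continuous_coe.comp (.pow (.div₀ continuous_const ?_ ?_) _))
    · exact continuous_im.subtype_mk _
    · exact fun τ ↦ NNReal.ne_iff.mp τ.im_ne_zero
  · simp [← NNReal.coe_eq_zero, τ.im_ne_zero]

lemma volume_verticalStrip_lt_top (a b : ℝ) {y : ℝ} (hy : 0 < y) :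
    volume {τ : ℍ | τ.re ∈ Set.Icc a b ∧ y < τ.im} < ⊤ := by
  have himage : UpperHalfPlane.coe '' {τ : ℍ | τ.re ∈ Set.Icc a b ∧ y < τ.im} ⊆
      Complex.measurableEquivRealProd ⁻¹' (Set.Icc a b ×ˢ Set.Ioi y) := by
    rintro _ ⟨τ, hτ, rfl⟩
    exact hτ
  have hint : IntegrableOn (fun p : ℝ × ℝ ↦ 1 * p.2 ^ (-2 : ℝ)) (Set.Icc a b ×ˢ Set.Ioi y) := by
    rw [IntegrableOn, Measure.volume_eq_prod, ← Measure.prod_restrict]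
    have hconst : IntegrableOn (fun _ : ℝ ↦ (1 : ℝ)) (Set.Icc a b) := integrableOn_const (by simp)
    exact Integrable.mul_prod hconst (integrableOn_Ioi_rpow_of_lt (by norm_num) hy)
  calc volume {τ : ℍ | τ.re ∈ Set.Icc a b ∧ y < τ.im}
      ≤ ∫⁻ z in Complex.measurableEquivRealProd ⁻¹' (Set.Icc a b ×ˢ Set.Ioi y),
          ↑((1 / ‖z.im‖₊) ^ 2 : NNReal) := by
        rw [volume_eq_lintegral]
        exact lintegral_mono_set himage
    _ = ∫⁻ p in Set.Icc a b ×ˢ Set.Ioi y, ↑((1 / ‖p.2‖₊) ^ 2 : NNReal) :=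
        Complex.volume_preserving_equiv_real_prod.setLIntegral_comp_preimage_emb
          Complex.measurableEquivRealProd.measurableEmbedding
          (fun p : ℝ × ℝ ↦ ↑((1 / ‖p.2‖₊) ^ 2 : NNReal)) _
    _ = ∫⁻ p in Set.Icc a b ×ˢ Set.Ioi y, ‖(1 * p.2 ^ (-2 : ℝ) : ℝ)‖ₑ := by
        refine setLIntegral_congr_fun (measurableSet_Icc.prod measurableSet_Ioi) fun p _ ↦ ?_
        rw [enorm_eq_nnnorm]
        norm_cast
        ext
        simp
    _ < ⊤ := hint.2

lemma volume_fd_lt_top : volume ModularGroup.fd < ⊤ := by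
  refine (measure_mono fun τ hτ ↦ ?_).trans_lt
    (volume_verticalStrip_lt_top (-1 / 2) (1 / 2) one_half_pos)
  have him := ModularGroup.three_le_four_mul_im_sq_of_mem_fd hτ
  have hre := abs_le.mp hτ.2
  exact ⟨⟨by linarith [hre.1], hre.2⟩, by nlinarith [τ.im_pos]⟩

section CosetSums

variable {G A : Type*} [Group G]

lemma apply_quotient_out {H : Subgroup G} {F : G → A} (hF : ∀ g, ∀ h ∈ H, F (g * h) = F g)
    (g : G) : F (g : G ⧸ H).out = F g := by
  obtain ⟨h, hh⟩ := QuotientGroup.mk_out_eq_mul H g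
  rw [hh, hF _ _ h.2]

variable [AddCommMonoid A]

lemma finsum_quotient_eq_finsum_finsum {H K : Subgroup G} [H.FiniteIndex] (hHK : H ≤ K)
    {F : G → A} (hF : ∀ g, ∀ h ∈ H, F (g * h) = F g) :
    ∑ᶠ c : G ⧸ H, F c.out =
      ∑ᶠ a : G ⧸ K, ∑ᶠ b : K ⧸ H.subgroupOf K, F (a.out * (b.out : K)) := by
  have : K.FiniteIndex := Subgroup.finiteIndex_of_le hHK
  rw [← finsum_comp_equiv (Subgroup.quotientEquivProdOfLE hHK).symm,
    finsum_curry _ (Set.toFinite _)]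
  refine finsum_congr fun a ↦ finsum_congr fun b ↦ ?_
  rw [← apply_quotient_out hF (a.out * (b.out : K))]
  conv_lhs => rw [← QuotientGroup.out_eq' b]
  rfl

lemma finsum_quotient_eq_add_of_index_eq_two {H : Subgroup G} (hH : H.index = 2)
    {w : G} (hw : w ∉ H) {F : G → A} (hF : ∀ g, ∀ h ∈ H, F (g * h) = F g) :
    ∑ᶠ c : G ⧸ H, F c.out = F 1 + F w := by
  have hne : ((1 : G) : G ⧸ H) ≠ (w : G ⧸ H) := by
    simpa [QuotientGroup.eq] using hw
  obtain ⟨v, -, hv⟩ := (Nat.card_eq_two_iff' ((1 : G) : G ⧸ H)).mp hH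
  have huniv : Set.univ = {((1 : G) : G ⧸ H), (w : G ⧸ H)} := by
    refine (Set.eq_univ_of_forall fun c ↦ ?_).symm
    rw [hv w hne.symm]
    exact or_iff_not_imp_left.mpr (hv c)
  rw [← finsum_mem_univ, huniv, finsum_mem_pair hne, apply_quotient_out hF, apply_quotient_out hF]

end CosetSums

section Trace

variable {H K : Subgroup SL(2, ℤ)}

instance [H.FiniteIndex] : (H.map (mapGL ℝ)).IsFiniteRelIndex (K.map (mapGL ℝ)) := by
  rw [Subgroup.isFiniteRelIndex_iff_relIndex_ne_zero,
    Subgroup.relIndex_map_map_of_injective _ _ mapGL_injective]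
  have : H.IsFiniteRelIndex K := H.isFiniteRelIndex_of_finiteIndex
  exact Subgroup.relIndex_ne_zero

lemma slash_eq_of_mem {k : ℤ} (f : CuspForm H k) {γ : SL(2, ℤ)} (hγ : γ ∈ H) :
    (f : ℍ → ℂ) ∣[k] γ = f :=
  SlashInvariantFormClass.slash_action_eq f _ ⟨γ, hγ, rfl⟩

lemma coe_trace_eq_finsum [(H.map (mapGL ℝ)).IsFiniteRelIndex (K.map (mapGL ℝ))] {k : ℤ}
    (f : CuspForm H k) :
    ⇑(CuspForm.trace (K.map (mapGL ℝ)) f) =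
      ∑ᶠ b : K ⧸ H.subgroupOf K, (f : ℍ → ℂ) ∣[k] (b.out : SL(2, ℤ))⁻¹ := by
  let e : K ⧸ H.subgroupOf K ≃ K.map (mapGL ℝ) ⧸ (H.map (mapGL ℝ)).subgroupOf (K.map (mapGL ℝ)) :=
    Quotient.congr (K.equivMapOfInjective _ mapGL_injective).toEquiv fun a b ↦ by
      rw [QuotientGroup.leftRel_apply, QuotientGroup.leftRel_apply, Subgroup.mem_subgroupOf,
        Subgroup.mem_subgroupOf, MulEquiv.toEquiv_eq_coe, MulEquiv.coe_toEquiv, ← map_inv,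
        ← map_mul, Subgroup.coe_equivMapOfInjective_apply,
        Subgroup.mem_map_iff_mem mapGL_injective]
  let := Fintype.ofFinite (K.map (mapGL ℝ) ⧸ (H.map (mapGL ℝ)).subgroupOf (K.map (mapGL ℝ)))
  rw [CuspForm.coe_trace, ← finsum_eq_sum_of_fintype, ← finsum_comp_equiv e]
  refine finsum_congr fun b ↦ ?_
  conv_lhs => rw [← QuotientGroup.out_eq' b]
  change (f : ℍ → ℂ) ∣[k] (mapGL ℝ (b.out : SL(2, ℤ)))⁻¹ = _
  rw [← map_inv]
  rfl

lemma coe_trace_eq_add_slash [H.FiniteIndex] (hHK : H.relIndex K = 2) {k : ℤ}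
    (f : CuspForm H k) {w : SL(2, ℤ)} (hwK : w ∈ K) (hwH : w ∉ H) :
    ⇑(CuspForm.trace (K.map (mapGL ℝ)) f) = f + (f : ℍ → ℂ) ∣[k] w := by
  let F (b : K) : ℍ → ℂ := (f : ℍ → ℂ) ∣[k] (b : SL(2, ℤ))⁻¹
  have hF : ∀ b, ∀ h ∈ H.subgroupOf K, F (b * h) = F b := by
    intro b h hh
    simp only [F, Subgroup.coe_mul, mul_inv_rev, SlashAction.slash_mul]
    rw [slash_eq_of_mem f (γ := (h : SL(2, ℤ))⁻¹) (inv_mem hh)]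
  have hw : (⟨w⁻¹, inv_mem hwK⟩ : K) ∉ H.subgroupOf K := by
    simpa [Subgroup.mem_subgroupOf] using hwH
  calc ⇑(CuspForm.trace (K.map (mapGL ℝ)) f)
      = ∑ᶠ b : K ⧸ H.subgroupOf K, F b.out := coe_trace_eq_finsum f
    _ = F 1 + F ⟨w⁻¹, inv_mem hwK⟩ := finsum_quotient_eq_add_of_index_eq_two hHK hw hF
    _ = f + (f : ℍ → ℂ) ∣[k] w := by simp [F]

end Trace

section PeterssonBound

variable {k : ℤ}

lemma petersson_self (k : ℤ) (f : ℍ → ℂ) (τ : ℍ) :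
    petersson k f f τ = ((‖f τ‖ ^ 2 * τ.im ^ k : ℝ) : ℂ) := by
  rw [petersson, Complex.conj_mul']
  push_cast
  rfl

variable {𝒢 ℋ : Subgroup (GL (Fin 2) ℝ)} [𝒢.IsArithmetic] [ℋ.IsArithmetic]

lemma exists_norm_petersson_le (f : CuspForm 𝒢 k) (g : CuspForm ℋ k) :
    ∃ C, ∀ τ, ‖petersson k f g τ‖ ≤ C := by
  obtain ⟨A, hA⟩ := CuspFormClass.exists_bound f
  obtain ⟨B, hB⟩ := CuspFormClass.exists_bound g
  refine ⟨A * B, fun τ ↦ ?_⟩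
  have hzpow : τ.im ^ (k / 2 : ℝ) * τ.im ^ (k / 2 : ℝ) = τ.im ^ k := by
    rw [← Real.rpow_add τ.im_pos, add_halves, Real.rpow_intCast]
  have : 0 < τ.im ^ (k / 2 : ℝ) := Real.rpow_pos_of_pos τ.im_pos _
  calc ‖petersson k f g τ‖ = ‖f τ‖ * ‖g τ‖ * τ.im ^ k := by
        simp [petersson, abs_of_pos τ.im_pos]
    _ ≤ (A / τ.im ^ (k / 2 : ℝ)) * (B / τ.im ^ (k / 2 : ℝ)) * τ.im ^ k := by
        gcongr
        · exact (norm_nonneg _).trans (hA τ)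
        · exact hA τ
        · exact hB τ
    _ = A * B := by rw [← hzpow]; field_simp

lemma integrableOn_fd_petersson_smul (f : CuspForm 𝒢 k) (g : CuspForm ℋ k)
    (γ : SL(2, ℤ)) :
    IntegrableOn (fun τ : ℍ ↦ petersson k f g (γ • τ)) ModularGroup.fd := by
  obtain ⟨C, hC⟩ := exists_norm_petersson_le f g
  have hcont : Continuous (petersson k f g) :=
    petersson_continuous k (CuspFormClass.holo f).continuous (CuspFormClass.holo g).continuous
  exact Measure.integrableOn_of_bounded volume_fd_lt_top.ne
    (hcont.comp (continuous_const_smul (γ : GL (Fin 2) ℝ))).aestronglyMeasurable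
    (.of_forall fun τ ↦ hC _)

end PeterssonBound

section PeterssonProduct

variable {k : ℤ} {𝒢 : Subgroup (GL (Fin 2) ℝ)}

lemma nonempty_fdo : ModularGroup.fdo.Nonempty := by
  refine ⟨⟨2 * Complex.I, by simp⟩, ?_, ?_⟩
  · norm_num [Complex.normSq_apply]
  · simp [UpperHalfPlane.re]

lemma eqOn_fdo_of_setIntegral_fd_eq_zero {φ : ℍ → ℝ} (hcont : Continuous φ) (hφ : 0 ≤ φ)
    (hint : IntegrableOn φ ModularGroup.fd) (h : ∫ τ in ModularGroup.fd, φ τ = 0) :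
    Set.EqOn φ 0 ModularGroup.fdo := by
  rw [setIntegral_eq_zero_iff_of_nonneg_ae (.of_forall hφ) hint] at h
  exact Measure.eqOn_open_of_ae_eq
    (ae_restrict_of_ae_restrict_of_subset ModularGroup.fdo_subset_fd h)
    ModularGroup.isOpen_fdo hcont.continuousOn continuousOn_const

lemma eq_zero_of_eqOn_smul_fdo (f : CuspForm 𝒢 k) (γ : SL(2, ℤ))
    (h : ∀ τ ∈ ModularGroup.fdo, f (γ • τ) = 0) : f = 0 := by
  obtain ⟨τ, hτ⟩ := nonempty_fdo
  have hγ : Tendsto (fun z : ℍ ↦ γ⁻¹ • z) (𝓝 (γ • τ)) (𝓝 τ) := by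
    simpa using! (continuous_const_smul ((γ⁻¹ : SL(2, ℤ)) : GL (Fin 2) ℝ)).tendsto (γ • τ)
  have hev : ∀ᶠ z in 𝓝 (γ • τ), f z = 0 := by
    filter_upwards [hγ (ModularGroup.isOpen_fdo.mem_nhds hτ)] with z hz
    simpa only [smul_inv_smul] using h _ hz
  exact DFunLike.coe_injective <| eq_zero_of_frequently (CuspFormClass.holo f)
    (hev.filter_mono nhdsWithin_le_nhds).frequently

variable [𝒢.IsArithmetic]

lemma eq_zero_of_setIntegral_petersson_self_eq_zero (f : CuspForm 𝒢 k) (γ : SL(2, ℤ))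
    (h : ∫ τ in ModularGroup.fd, petersson k f f (γ • τ) = 0) : f = 0 := by
  have hint := integrableOn_fd_petersson_smul f f γ
  have hcont : Continuous fun τ : ℍ ↦ petersson k f f (γ • τ) :=
    (petersson_continuous k (CuspFormClass.holo f).continuous
      (CuspFormClass.holo f).continuous).comp (continuous_const_smul (γ : GL (Fin 2) ℝ))
  have hzero := eqOn_fdo_of_setIntegral_fd_eq_zero (Complex.continuous_re.comp hcont)
    (fun τ ↦ by
      rw [Function.comp_apply, petersson_self, Complex.ofReal_re]
      exact mul_nonneg (sq_nonneg _) (zpow_nonneg (γ • τ).im_pos.le k))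
    hint.re ((integral_re hint).trans (by rw [h]; simp))
  refine eq_zero_of_eqOn_smul_fdo f γ fun τ hτ ↦ ?_
  have := hzero hτ
  rw [Function.comp_apply, petersson_self, Complex.ofReal_re] at this
  simpa using (mul_eq_zero.mp this).resolve_right (zpow_ne_zero k (γ • τ).im_ne_zero)

/-- The Petersson product of weight `k` over the quotient `Γ \ ℍ`, in the normalization of
`peterssonInner`, which is the case of weight two and `Γ = Γ₀(N)`. -/
def peterssonProduct (Γ : Subgroup SL(2, ℤ)) (k : ℤ) (f g : ℍ → ℂ) : ℂ :=
  ∑ᶠ c : SL(2, ℤ) ⧸ Γ, ∫ τ in ModularGroup.fd, petersson k f g (c.out⁻¹ • τ)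

variable {H K : Subgroup SL(2, ℤ)}

lemma eq_zero_of_peterssonProduct_self_eq_zero [H.FiniteIndex] (f : CuspForm H k)
    (h : peterssonProduct H k f f = 0) : f = 0 := by
  have := Fintype.ofFinite (SL(2, ℤ) ⧸ H)
  have hreal (γ : SL(2, ℤ)) : ∫ τ in ModularGroup.fd, petersson k f f (γ • τ) =
      ((∫ τ in ModularGroup.fd, ‖f (γ • τ)‖ ^ 2 * (γ • τ).im ^ k : ℝ) : ℂ) := by
    simp only [petersson_self, integral_complex_ofReal]
  have hnonneg (γ : SL(2, ℤ)) :
      0 ≤ ∫ τ in ModularGroup.fd, ‖f (γ • τ)‖ ^ 2 * (γ • τ).im ^ k :=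
    integral_nonneg fun τ ↦ mul_nonneg (sq_nonneg _) (zpow_nonneg (γ • τ).im_pos.le k)
  simp only [peterssonProduct, finsum_eq_sum_of_fintype, hreal] at h
  norm_cast at h
  rw [Finset.sum_eq_zero_iff_of_nonneg fun c _ ↦ hnonneg _] at h
  let c : SL(2, ℤ) ⧸ H := (1 : SL(2, ℤ))
  refine eq_zero_of_setIntegral_petersson_self_eq_zero f c.out⁻¹ ?_
  rw [hreal, h c (Finset.mem_univ c), Complex.ofReal_zero]

lemma petersson_trace_left [H.FiniteIndex] (f : CuspForm H k) (g : CuspForm K k) (τ : ℍ) :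
    petersson k (CuspForm.trace (K.map (mapGL ℝ)) f) g τ =
      ∑ᶠ b : K ⧸ H.subgroupOf K, petersson k f g ((b.out : SL(2, ℤ))⁻¹ • τ) := by
  let := Fintype.ofFinite (K ⧸ H.subgroupOf K)
  simp only [coe_trace_eq_finsum, finsum_eq_sum_of_fintype, ← petersson_slash_SL]
  simp only [petersson, Finset.sum_apply, map_sum, Finset.sum_mul,
    slash_eq_of_mem g (inv_mem (Subtype.coe_prop _))]

lemma setIntegral_petersson_trace_left [H.FiniteIndex] [K.FiniteIndex] (f : CuspForm H k)
    (g : CuspForm K k) (γ : SL(2, ℤ)) :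
    ∫ τ in ModularGroup.fd, petersson k (CuspForm.trace (K.map (mapGL ℝ)) f) g (γ⁻¹ • τ) =
      ∑ᶠ b : K ⧸ H.subgroupOf K,
        ∫ τ in ModularGroup.fd, petersson k f g ((γ * (b.out : SL(2, ℤ)))⁻¹ • τ) := by
  let := Fintype.ofFinite (K ⧸ H.subgroupOf K)
  simp only [petersson_trace_left, finsum_eq_sum_of_fintype, mul_inv_rev, mul_smul]
  refine integral_finsetSum _ fun b _ ↦ ?_
  simp only [← mul_smul]
  exact integrableOn_fd_petersson_smul f g _

lemma peterssonProduct_trace_left [H.FiniteIndex] [K.FiniteIndex] (hHK : H ≤ K)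
    (f : CuspForm H k) (g : CuspForm K k) :
    peterssonProduct K k (CuspForm.trace (K.map (mapGL ℝ)) f) g = peterssonProduct H k f g := by
  let F (γ : SL(2, ℤ)) : ℂ := ∫ τ in ModularGroup.fd, petersson k f g (γ⁻¹ • τ)
  have hF : ∀ γ, ∀ h ∈ H, F (γ * h) = F γ := by
    intro γ h hh
    simp only [F, mul_inv_rev, mul_smul]
    congr! 2 with τ
    rw [← petersson_slash_SL, slash_eq_of_mem f (inv_mem hh), slash_eq_of_mem g (inv_mem (hHK hh))]
  calc peterssonProduct K k (CuspForm.trace (K.map (mapGL ℝ)) f) g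
      = ∑ᶠ a : SL(2, ℤ) ⧸ K, ∑ᶠ b : K ⧸ H.subgroupOf K, F (a.out * (b.out : SL(2, ℤ))) :=
        finsum_congr fun a ↦ setIntegral_petersson_trace_left f g a.out
    _ = ∑ᶠ c : SL(2, ℤ) ⧸ H, F c.out := (finsum_quotient_eq_finsum_finsum hHK hF).symm

theorem trace_eq_zero_of_peterssonProduct_eq_zero [H.FiniteIndex] (hHK : H ≤ K)
    (f : CuspForm H k) (hf : ∀ g : CuspForm K k, peterssonProduct H k f g = 0) :
    CuspForm.trace (K.map (mapGL ℝ)) f = 0 := by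
  have : K.FiniteIndex := Subgroup.finiteIndex_of_le hHK
  refine eq_zero_of_peterssonProduct_self_eq_zero _ ?_
  rw [peterssonProduct_trace_left hHK, hf]

end PeterssonProduct

/-! ### The levels `Γ₀(2m)` and `Γ₀(4m)` -/

section Level

lemma mem_Gamma0_iff_dvd {N : ℕ} {g : SL(2, ℤ)} : g ∈ Gamma0 N ↔ (N : ℤ) ∣ g 1 0 := by
  rw [Gamma0_mem, ZMod.intCast_zmod_eq_zero_iff_dvd]

lemma Gamma0_le_of_dvd {M N : ℕ} (h : M ∣ N) : Gamma0 N ≤ Gamma0 M := fun _ hg ↦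
  mem_Gamma0_iff_dvd.mpr <| (Int.natCast_dvd_natCast.mpr h).trans (mem_Gamma0_iff_dvd.mp hg)

lemma wMat_mem_Gamma0 (m : ℕ) : wMat m ∈ Gamma0 (2 * m) :=
  mem_Gamma0_iff_dvd.mpr (by simp [wMat])

lemma wMat_notMem_Gamma0 {m : ℕ} (hm : 0 < m) : wMat m ∉ Gamma0 (4 * m) := by
  rw [mem_Gamma0_iff_dvd]
  rintro ⟨k, hk⟩
  have : 2 * (m : ℤ) * (2 * k) = 2 * m * 1 := by
    simpa [wMat, mul_assoc, mul_left_comm, mul_comm] using hk.symm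
  have := mul_left_cancel₀ (by positivity) this
  omega

lemma mul_wMat_mem_or_mem {m : ℕ} {g : SL(2, ℤ)} (hg : g ∈ Gamma0 (2 * m)) :
    g * wMat m ∈ Gamma0 (4 * m) ∨ g ∈ Gamma0 (4 * m) := by
  simp only [mem_Gamma0_iff_dvd] at *
  obtain ⟨k, hk⟩ := hg
  push_cast at hk ⊢
  have hentry : (g * wMat m) 1 0 = 2 * m * (k + g 1 1) := by
    rw [Matrix.SpecialLinearGroup.coe_mul, Matrix.mul_apply, Fin.sum_univ_two, hk]
    simp only [wMat, Matrix.of_apply, Matrix.cons_val]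
    ring
  have hodd : Odd (g 1 1) := by
    have hdet : g 0 0 * g 1 1 = 2 * (g 0 1 * m * k) + 1 := by
      linear_combination (Matrix.det_fin_two _).symm.trans g.det_coe + g 0 1 * hk
    exact (Int.odd_mul.mp ⟨_, hdet⟩).2
  rcases Int.even_or_odd k with ⟨l, rfl⟩ | hk'
  · exact .inr ⟨l, by rw [hk]; ring⟩
  · obtain ⟨l, hl⟩ := hk'.add_odd hodd
    exact .inl ⟨l, by rw [hentry, hl]; ring⟩

lemma relIndex_Gamma0_four_mul {m : ℕ} (hm : 0 < m) :
    (Gamma0 (4 * m)).relIndex (Gamma0 (2 * m)) = 2 :=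
  Subgroup.relIndex_eq_two_iff_exists_notMem_and.mpr
    ⟨wMat m, wMat_mem_Gamma0 m, wMat_notMem_Gamma0 hm, fun _ ↦ mul_wMat_mem_or_mem⟩

lemma dilate_one (f : ℍ → ℂ) : dilate 1 f = f := by
  funext τ
  simp [dilate]

lemma IsNew.peterssonInner_eq_zero {M N : ℕ} {f : CuspForm (Gamma0 N) 2} (hf : IsNew f)
    (hMN : M ≠ N) (hdvd : M ∣ N) (g : CuspForm (Gamma0 M) 2) : peterssonInner N f g = 0 := by
  simpa only [dilate_one] using hf M 1 hMN (by rwa [one_mul]) g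

theorem slash_wMat_eq_neg {m : ℕ} (hm : 0 < m) (f : CuspForm (Gamma0 (4 * m)) 2)
    (hf : ∀ g : CuspForm (Gamma0 (2 * m)) 2, peterssonInner (4 * m) f g = 0) :
    (f : ℍ → ℂ) ∣[(2 : ℤ)] wMat m = -f := by
  have : NeZero (4 * m) := ⟨by positivity⟩
  have htrace :=
    trace_eq_zero_of_peterssonProduct_eq_zero (Gamma0_le_of_dvd ⟨2, by ring⟩) f hf
  rw [eq_neg_iff_add_eq_zero, add_comm, ← coe_trace_eq_add_slash
    (relIndex_Gamma0_four_mul hm) f (wMat_mem_Gamma0 m) (wMat_notMem_Gamma0 hm), htrace]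
  rfl

end Level

/-! ### The Eichler integral -/

section Primitive

variable {f G P : ℍ → ℂ}

/-- `G` is a primitive of the differential form `2πi f(z) dz` on the upper half-plane. -/
def IsPrimitive (f G : ℍ → ℂ) : Prop :=
  ∀ τ : ℍ, HasDerivAt (G ∘ ofComplex) (2 * Real.pi * Complex.I * f τ) τ

lemma IsPrimitive.continuous (hG : IsPrimitive f G) : Continuous G := by
  refine continuous_iff_continuousAt.mpr fun τ ↦ ?_
  simpa [Function.comp_def] using!
    (hG τ).continuousAt.comp (x := τ) UpperHalfPlane.continuous_coe.continuousAt

lemma IsPrimitive.exists_eq_add_const (hG : IsPrimitive f G) (hP : IsPrimitive f P) :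
    ∃ K, ∀ τ, G τ = P τ + K := by
  have hderiv (z : ℂ) (hz : z ∈ upperHalfPlaneSet) :
      HasDerivAt (G ∘ ofComplex - P ∘ ofComplex) 0 z :=
    ((hG ⟨z, hz⟩).sub (hP ⟨z, hz⟩)).congr_deriv (sub_self _)
  obtain ⟨K, hK⟩ := isOpen_upperHalfPlaneSet.exists_is_const_of_deriv_eq_zero
    (convex_halfSpace_im_gt 0).isPreconnected
    (fun z hz ↦ (hderiv z hz).differentiableAt.differentiableWithinAt)
    (fun z hz ↦ (hderiv z hz).deriv)
  refine ⟨K, fun τ ↦ ?_⟩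
  simpa [sub_eq_iff_eq_add'] using hK τ τ.im_pos

lemma IsPrimitive.comp_smul (hG : IsPrimitive f G) (g : SL(2, ℤ)) :
    IsPrimitive (f ∣[(2 : ℤ)] g) fun τ ↦ G (g • τ) := by
  intro τ
  have hdet : (g : GL (Fin 2) ℝ).val.det = 1 :=
    (Matrix.SpecialLinearGroup.map (Int.castRingHom ℝ) g).det_coe
  have hsmul := (hasStrictDerivAt_smul (g := (g : GL (Fin 2) ℝ)) (hdet ▸ one_pos) τ).hasDerivAt
  have hG' : HasDerivAt (G ∘ ofComplex) (2 * Real.pi * Complex.I * f (g • τ))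
      ↑(g • ofComplex (τ : ℂ)) := by
    rw [ofComplex_apply]
    exact hG (g • τ)
  have hcomp := HasDerivAt.comp (τ : ℂ) (h := fun z : ℂ ↦ (↑(g • ofComplex z) : ℂ)) hG' hsmul
  simp only [Function.comp_def, ofComplex_apply] at hcomp
  refine hcomp.congr_deriv ?_
  rw [ModularForm.SL_slash_apply, hdet, zpow_neg, Complex.ofReal_one, one_div]
  norm_cast
  ring

lemma hasDerivAt_qParam (h : ℝ) (z : ℂ) :
    HasDerivAt (Function.Periodic.qParam h)
      (Function.Periodic.qParam h z * (2 * Real.pi * Complex.I / h)) z := by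
  unfold Function.Periodic.qParam
  refine HasDerivAt.cexp ?_
  simpa using ((hasDerivAt_id z).const_mul (2 * Real.pi * Complex.I)).div_const (h : ℂ)

variable {k : ℤ} {Γ : Subgroup (GL (Fin 2) ℝ)} [Γ.IsArithmetic]

theorem exists_isPrimitive_isZeroAtImInfty (f : CuspForm Γ k) :
    ∃ G, IsPrimitive f G ∧ IsZeroAtImInfty G := by
  set h := Γ.strictWidthInfty
  have hh : 0 < h := Γ.strictWidthInfty_pos
  have hΓ : h ∈ Γ.strictPeriods := Γ.strictWidthInfty_mem_strictPeriods
  -- In the parameter `q` of width `h`, the form `2πi f(z) dz` is `h F(q) / q dq` with `F(0) = 0`.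
  let F := cuspFunction h f
  have hF : DifferentiableOn ℂ (dslope F 0) (Metric.ball 0 1) := by
    rw [Complex.differentiableOn_dslope (Metric.ball_mem_nhds _ one_pos)]
    exact fun q hq ↦ (ModularFormClass.differentiableAt_cuspFunction f hh hΓ
      (mem_ball_zero_iff.mp hq)).differentiableWithinAt
  have hF0 : F 0 = 0 := CuspFormClass.cuspFunction_apply_zero f hh hΓ
  have hslope (τ : ℍ) : Function.Periodic.qParam h τ *
      dslope F 0 (Function.Periodic.qParam h τ) = f τ := by
    rw [← SlashInvariantFormClass.eq_cuspFunction f τ hΓ hh.ne']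
    simpa [hF0] using sub_smul_dslope F 0 (Function.Periodic.qParam h τ)
  obtain ⟨P, hP0, hP⟩ := hF.isExactOn_ball.with_val_at 0 0
  refine ⟨fun τ ↦ h * P (Function.Periodic.qParam h τ), fun τ ↦ ?_, ?_⟩
  · have hq : Function.Periodic.qParam h τ ∈ Metric.ball 0 1 :=
      mem_ball_zero_iff.mpr (Function.Periodic.norm_qParam_lt_one hh τ.im_pos)
    have hder := ((hP _ hq).comp (τ : ℂ) (hasDerivAt_qParam h τ)).const_mul (h : ℂ)
    have hhc : (h : ℂ) ≠ 0 := mod_cast hh.ne'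
    refine (hder.congr_deriv ?_).congr_of_eventuallyEq ?_
    · rw [← hslope]
      field_simp
    · filter_upwards [eventuallyEq_coe_comp_ofComplex τ.im_pos] with z hz
      simp only [Function.comp_apply, id] at hz ⊢
      rw [hz]
  · have hcont : Tendsto P (𝓝 0) (𝓝 0) := by
      simpa [hP0] using (hP 0 (by simp)).continuousAt.tendsto
    simpa [IsZeroAtImInfty, ZeroAtFilter] using
      (hcont.comp (qParam_tendsto_atImInfty hh)).const_mul (h : ℂ)

end Primitive

section VerticalLine

/-- The point `z + i t` of the vertical half-line above `z`, where `im z ≥ 0`; meaningful only for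
`im z + t > 0`, since `ofComplex` has a junk value outside the upper half-plane. -/
def vertical (z : ℂ) (t : ℝ) : ℍ :=
  ofComplex (z + t * Complex.I)

variable {z : ℂ} {t : ℝ}

lemma coe_vertical (hz : 0 ≤ z.im) (ht : 0 < t) : (vertical z t : ℂ) = z + t * Complex.I := by
  rw [vertical, ofComplex_apply_of_im_pos (by simpa using by positivity)]

lemma im_vertical (hz : 0 ≤ z.im) (ht : 0 < t) : (vertical z t).im = z.im + t := by
  rw [← coe_im, coe_vertical hz ht]
  simp

lemma continuousOn_vertical (hz : 0 ≤ z.im) : ContinuousOn (vertical z) (Set.Ioi 0) := by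
  rw [isOpenEmbedding_coe.isInducing.continuousOn_iff]
  exact ContinuousOn.congr (f := fun t : ℝ ↦ z + t * Complex.I) (by fun_prop)
    fun t ht ↦ coe_vertical hz ht

lemma tendsto_vertical_atTop (z : ℂ) : Tendsto (vertical z) atTop atImInfty := by
  refine tendsto_comap_im_ofComplex.comp (tendsto_comap_iff.mpr ?_)
  simpa [Function.comp_def] using tendsto_atTop_add_const_left atTop z.im tendsto_id

lemma tendsto_vertical_nhdsGT_zero (τ : ℍ) : Tendsto (vertical τ) (𝓝[>] 0) (𝓝 τ) := by
  rw [isOpenEmbedding_coe.isInducing.tendsto_nhds_iff]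
  have hline : Tendsto (fun t : ℝ ↦ (τ : ℂ) + t * Complex.I) (𝓝 0) (𝓝 τ) := by
    simpa using (by fun_prop : Continuous fun t : ℝ ↦ (τ : ℂ) + t * Complex.I).tendsto 0
  refine (hline.mono_left nhdsWithin_le_nhds).congr' ?_
  filter_upwards [self_mem_nhdsWithin] with t ht
  exact (coe_vertical τ.im_pos.le ht).symm

lemma IsPrimitive.hasDerivAt_vertical {f G : ℍ → ℂ} (hG : IsPrimitive f G) (hz : 0 ≤ z.im)
    (ht : 0 < t) :
    HasDerivAt (fun s ↦ G (vertical z s))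
      (2 * Real.pi * Complex.I * f (vertical z t) * Complex.I) t := by
  have hline : HasDerivAt (fun s : ℝ ↦ z + s * Complex.I) Complex.I t := by
    simpa using (Complex.ofRealCLM.hasDerivAt (x := t)).mul_const Complex.I |>.const_add z
  have hG' := hG (vertical z t)
  rw [coe_vertical hz ht] at hG'
  exact HasDerivAt.comp t (h := fun s : ℝ ↦ z + s * Complex.I) hG' hline

lemma integral_Ioi_of_hasDerivAt_of_tendsto_nhdsGT {E : Type*} [NormedAddCommGroup E]
    [NormedSpace ℝ E] [CompleteSpace E] {F F' : ℝ → E} {a : ℝ} {A B : E}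
    (hderiv : ∀ t ∈ Set.Ioi a, HasDerivAt F (F' t) t) (hint : IntegrableOn F' (Set.Ioi a))
    (ha : Tendsto F (𝓝[>] a) (𝓝 A)) (htop : Tendsto F atTop (𝓝 B)) :
    ∫ t in Set.Ioi a, F' t = B - A := by
  have hcont : ContinuousWithinAt (Function.update F a A) (Set.Ici a) a := by
    rwa [continuousWithinAt_update_same, Set.Ici_sdiff_left]
  have heq {t : ℝ} (ht : a < t) : Function.update F a A t = F t := Function.update_of_ne ht.ne' _ _
  have hupd := integral_Ioi_of_hasDerivAt_of_tendsto hcont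
    (fun t ht ↦ (hderiv t ht).congr_of_eventuallyEq
      ((eventually_gt_nhds ht).mono fun _ ↦ heq)) hint
    (htop.congr' ((eventually_gt_atTop a).mono fun _ ht ↦ (heq ht).symm))
  rwa [Function.update_self] at hupd

variable {k : ℤ} {Γ : Subgroup (GL (Fin 2) ℝ)} [Γ.IsArithmetic] (f : CuspForm Γ k)
include f

lemma isBigO_vertical_exp_neg (hz : 0 ≤ z.im) :
    ∃ c > 0, (fun t ↦ f (vertical z t)) =O[atTop] fun t ↦ Real.exp (-c * t) := by
  obtain ⟨c, hc, hO⟩ := CuspFormClass.exp_decay_atImInfty' f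
  refine ⟨c, hc, (hO.comp_tendsto (tendsto_vertical_atTop z)).trans (.of_bound 1 ?_)⟩
  filter_upwards [eventually_gt_atTop 0] with t ht
  rw [Function.comp_apply, im_vertical hz ht, one_mul, Real.norm_of_nonneg (Real.exp_nonneg _),
    Real.norm_of_nonneg (Real.exp_nonneg _), Real.exp_le_exp]
  nlinarith

lemma integrableOn_vertical (hz : 0 ≤ z.im) {b : ℂ}
    (hb : Tendsto (fun t ↦ f (vertical z t)) (𝓝[>] 0) (𝓝 b)) :
    IntegrableOn (fun t ↦ f (vertical z t)) (Set.Ioi 0) := by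
  have hcont : ContinuousOn (fun t ↦ f (vertical z t)) (Set.Ioi 0) :=
    (CuspFormClass.holo f).continuous.comp_continuousOn (continuousOn_vertical hz)
  rw [integrableOn_Ioi_iff_integrableAtFilter_atTop_nhdsWithin]
  refine ⟨?_, ?_, hcont.locallyIntegrableOn measurableSet_Ioi⟩
  · obtain ⟨c, hc, hO⟩ := isBigO_vertical_exp_neg f hz
    exact hO.integrableAtFilter
      ⟨Set.Ioi 0, Ioi_mem_atTop 0, hcont.aestronglyMeasurable measurableSet_Ioi⟩
      ⟨Set.Ioi 0, Ioi_mem_atTop 0, exp_neg_integrableOn_Ioi 0 hc⟩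
  · exact hb.integrableAtFilter
      (hcont.stronglyMeasurableAtFilter_nhdsWithin measurableSet_Ioi _)
      (Measure.finiteAt_nhdsWithin _ _ _)

variable {G : ℍ → ℂ}

lemma verticalIntegral_eq_of_tendsto (hG : IsPrimitive f G) (hG0 : IsZeroAtImInfty G)
    (hz : 0 ≤ z.im) {b K : ℂ} (hb : Tendsto (fun t ↦ f (vertical z t)) (𝓝[>] 0) (𝓝 b))
    (hK : Tendsto (fun t ↦ G (vertical z t)) (𝓝[>] 0) (𝓝 K)) :
    verticalIntegral f z = K := by
  have hint := ((integrableOn_vertical f hz hb).const_mul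
    (2 * Real.pi * Complex.I)).mul_const Complex.I
  calc verticalIntegral f z = -(0 - K) :=
        congrArg Neg.neg <| integral_Ioi_of_hasDerivAt_of_tendsto_nhdsGT
          (fun _ ↦ hG.hasDerivAt_vertical hz) hint hK (hG0.comp (tendsto_vertical_atTop z))
    _ = K := by ring

lemma eichler_point (hG : IsPrimitive f G) (hG0 : IsZeroAtImInfty G) (τ : ℍ) :
    eichler f (.point τ) = G τ :=
  verticalIntegral_eq_of_tendsto f hG hG0 τ.im_pos.le
    (((CuspFormClass.holo f).continuous.tendsto τ).comp (tendsto_vertical_nhdsGT_zero τ))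
    ((hG.continuous.tendsto τ).comp (tendsto_vertical_nhdsGT_zero τ))

end VerticalLine

section Cusps

variable {k : ℤ} {Γ : Subgroup (GL (Fin 2) ℝ)} [Γ.IsArithmetic]

open Pointwise in
instance (g : SL(2, ℤ)) : (ConjAct.toConjAct (g : GL (Fin 2) ℝ)⁻¹ • Γ).IsArithmetic := by
  simpa [(show Rat.castHom ℝ = algebraMap ℚ ℝ by rfl), map_inv,
    Matrix.SpecialLinearGroup.map_mapGL]
    using! Subgroup.IsArithmetic.conj Γ (mapGL ℚ g)⁻¹

lemma tendsto_im_zpow_mul_norm (f : CuspForm Γ k) (n : ℤ) :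
    Tendsto (fun τ : ℍ ↦ τ.im ^ n * ‖f τ‖) atImInfty (𝓝 0) := by
  obtain ⟨c, hc, hO⟩ := CuspFormClass.exp_decay_atImInfty' f
  have hdecay : Tendsto (fun τ : ℍ ↦ τ.im ^ n * Real.exp (-c * τ.im)) atImInfty (𝓝 0) := by
    simpa only [Function.comp_def, Real.rpow_intCast] using!
      (tendsto_rpow_mul_exp_neg_mul_atTop_nhds_zero n c hc).comp tendsto_comap
  exact ((Asymptotics.isBigO_refl _ _).mul hO.norm_left).trans_tendsto hdecay

/-- The vertical half-line above the cusp `g ∞ = g₀₀ / g₁₀`, for `g₁₀ ≠ 0` (if `g₁₀ = 0`, the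
quotient has the junk value `0`). -/
abbrev cuspVertical (g : SL(2, ℤ)) : ℝ → ℍ :=
  vertical ((g 0 0 / g 1 0 : ℚ) : ℂ)

section CuspVertical

variable {g : SL(2, ℤ)} (hg : g 1 0 ≠ 0) {t : ℝ}
include hg

lemma denom_inv_cuspVertical (ht : 0 < t) :
    denom (g⁻¹ : SL(2, ℤ)) (cuspVertical g t) = -(g 1 0 * t * Complex.I) := by
  have hc : ((g 1 0 : ℤ) : ℂ) ≠ 0 := mod_cast hg
  rw [ModularGroup.denom_apply, coe_vertical (by simp) ht,
    Matrix.SpecialLinearGroup.coe_inv, Matrix.adjugate_fin_two]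
  push_cast
  simp only [Matrix.of_apply, Matrix.cons_val', Matrix.cons_val_zero, Matrix.cons_val_fin_one,
    Matrix.cons_val_one, Int.cast_neg]
  field_simp
  ring

lemma im_inv_smul_cuspVertical (ht : 0 < t) :
    (g⁻¹ • cuspVertical g t).im = ((g 1 0 : ℝ) ^ 2 * t)⁻¹ := by
  rw [ModularGroup.im_smul_eq_div_normSq, denom_inv_cuspVertical hg ht, im_vertical (by simp) ht,
    Complex.normSq_neg, Complex.normSq_mul, Complex.normSq_mul, Complex.normSq_I,
    Complex.normSq_ofReal, Complex.normSq_intCast, Complex.ratCast_im]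
  have hc : (g 1 0 : ℝ) ≠ 0 := mod_cast hg
  field_simp
  ring

lemma tendsto_inv_smul_cuspVertical :
    Tendsto (fun t ↦ g⁻¹ • cuspVertical g t) (𝓝[>] 0) atImInfty := by
  have hc : 0 < ((g 1 0 : ℝ) ^ 2)⁻¹ := by
    have : (g 1 0 : ℝ) ≠ 0 := mod_cast hg
    positivity
  refine tendsto_comap_iff.mpr <| (tendsto_inv_nhdsGT_zero.const_mul_atTop hc).congr' ?_
  filter_upwards [self_mem_nhdsWithin] with t ht
  rw [Function.comp_apply, im_inv_smul_cuspVertical hg ht, mul_inv]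

lemma norm_apply_cuspVertical (f : ℍ → ℂ) (ht : 0 < t) :
    ‖f (cuspVertical g t)‖ = |(g 1 0 : ℝ)| ^ k *
      ((g⁻¹ • cuspVertical g t).im ^ k * ‖(f ∣[k] g) (g⁻¹ • cuspVertical g t)‖) := by
  have hc : |(g 1 0 : ℝ)| ≠ 0 := abs_ne_zero.mpr (mod_cast hg)
  have hdenom : ‖denom (g⁻¹ : SL(2, ℤ)) (cuspVertical g t)‖ =
      |(g 1 0 : ℝ)| * t := by
    rw [denom_inv_cuspVertical hg ht]
    simp [abs_of_pos ht]
  have hslash : f = (f ∣[k] g) ∣[k] g⁻¹ := by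
    rw [← SlashAction.slash_mul, mul_inv_cancel, SlashAction.slash_one]
  conv_lhs => rw [hslash]
  rw [ModularForm.SL_slash_apply, norm_mul, norm_zpow, hdenom, mul_comm, ← mul_assoc, ← mul_zpow,
    im_inv_smul_cuspVertical hg ht, zpow_neg, ← inv_zpow, ← sq_abs]
  congr 2
  field_simp

lemma tendsto_apply_cuspVertical_nhdsGT_zero (f : CuspForm Γ k) :
    Tendsto (fun t ↦ f (cuspVertical g t)) (𝓝[>] 0) (𝓝 0) := by
  have hslash := ((tendsto_im_zpow_mul_norm (CuspForm.translate f (g : GL (Fin 2) ℝ)) k).comp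
    (tendsto_inv_smul_cuspVertical hg)).const_mul (|(g 1 0 : ℝ)| ^ k)
  rw [mul_zero] at hslash
  refine tendsto_zero_iff_norm_tendsto_zero.mpr (hslash.congr' ?_)
  filter_upwards [self_mem_nhdsWithin] with t ht
  exact (norm_apply_cuspVertical hg f ht).symm

end CuspVertical

variable {G : ℍ → ℂ}

lemma eichler_cusp (f : CuspForm Γ k) (hG : IsPrimitive f G) (hG0 : IsZeroAtImInfty G)
    (g : SL(2, ℤ)) {K : ℂ} (hK : Tendsto (fun τ : ℍ ↦ G (g • τ)) atImInfty (𝓝 K)) :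
    eichler f (.cusp (mapGL ℚ g • OnePoint.infty)) = K := by
  rw [OnePoint.smul_infty_eq_ite]
  by_cases hg : g 1 0 = 0
  · rw [if_pos (by simp [hg])]
    have hg' : Tendsto (fun τ : ℍ ↦ g • τ) atImInfty atImInfty :=
      tendsto_smul_atImInfty (g := (g : GL (Fin 2) ℝ)) (by simp [hg])
    exact tendsto_nhds_unique (hG0.comp hg') hK
  · rw [if_neg (by simpa using hg)]
    have hlim := hK.comp (tendsto_inv_smul_cuspVertical hg)
    simp only [Function.comp_def, smul_inv_smul] at hlim
    exact verticalIntegral_eq_of_tendsto f hG hG0 (by simp)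
      (tendsto_apply_cuspVertical_nhdsGT_zero hg f) hlim

variable (f : CuspForm Γ 2)
include f

lemma IsPrimitive.exists_tendsto_comp_smul (hG : IsPrimitive f G) (g : SL(2, ℤ)) :
    ∃ K, Tendsto (fun τ : ℍ ↦ G (g • τ)) atImInfty (𝓝 K) := by
  obtain ⟨P, hP, hP0⟩ :=
    exists_isPrimitive_isZeroAtImInfty (CuspForm.translate f (g : GL (Fin 2) ℝ))
  obtain ⟨K, hK⟩ := (hG.comp_smul g).exists_eq_add_const hP
  refine ⟨K, ?_⟩
  simpa only [hK, zero_add] using hP0.add_const K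

theorem eichler_moebius (g : SL(2, ℤ)) (x : HStar) :
    eichler f (HStar.moebius g x) =
      eichler f (HStar.moebius g (.cusp OnePoint.infty)) + eichler (f ∣[(2 : ℤ)] g) x := by
  obtain ⟨G, hG, hG0⟩ := exists_isPrimitive_isZeroAtImInfty f
  let fg := CuspForm.translate f (g : GL (Fin 2) ℝ)
  obtain ⟨P, hP, hP0⟩ := exists_isPrimitive_isZeroAtImInfty fg
  obtain ⟨K, hK⟩ := (hG.comp_smul g).exists_eq_add_const hP
  have hinfty : eichler f (HStar.moebius g (.cusp OnePoint.infty)) = K :=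
    eichler_cusp f hG hG0 g (by simpa only [hK, zero_add] using hP0.add_const K)
  change _ = _ + eichler fg x
  rw [hinfty, add_comm]
  cases x with
  | point τ => rw [HStar.moebius, eichler_point f hG hG0, eichler_point fg hP hP0, hK]
  | cusp c =>
    obtain ⟨h, rfl⟩ := OnePoint.exists_mem_SL2 ℤ c
    obtain ⟨L, hL⟩ := hP.exists_tendsto_comp_smul fg h
    rw [HStar.moebius, ← mul_smul, ← map_mul, eichler_cusp fg hP hP0 h hL]
    exact eichler_cusp f hG hG0 (g * h) (by simpa only [mul_smul, hK] using hL.add_const K)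

end Cusps

lemma eichler_neg (f : ℍ → ℂ) (x : HStar) : eichler (-f) x = -eichler f x := by
  have hneg (z : ℂ) : verticalIntegral (-f) z = -verticalIntegral f z := by
    simp [verticalIntegral, integral_neg]
  match x with
  | .point τ => exact hneg τ
  | .cusp none => exact neg_zero.symm
  | .cusp (some r) => exact hneg r

lemma xCoord_eq_of_eichler_add_mem (W : WeierstrassCurve ℚ) (L : PeriodPair) {f : ℍ → ℂ}
    {x y : HStar} (h : eichler f x + eichler f y ∈ L.lattice) :
    xCoord W L f x = xCoord W L f y := by
  have hmem : eichler f x ∈ L.lattice ↔ eichler f y ∈ L.lattice :=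
    ⟨fun hx ↦ (add_mem_cancel_left hx).mp h, fun hy ↦ (add_mem_cancel_right hy).mp h⟩
  have hP : L.weierstrassP (eichler f x) = L.weierstrassP (eichler f y) := by
    rw [← L.weierstrassP_neg (eichler f y), ← L.weierstrassP_add_coe (-eichler f y) ⟨_, h⟩]
    ring_nf
  rw [xCoord, xCoord, hP]
  split_ifs <;> tauto

end ModularParam

end

theorem lemma8p2_general {m : ℕ} (hm : 0 < m) (f : CuspForm (Gamma0 (4 * m)) 2)
    (hf : ∀ g : CuspForm (Gamma0 (2 * m)) 2, ModularParam.peterssonInner (4 * m) f g = 0)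
    (W : WeierstrassCurve ℚ) (L : PeriodPair)
    (hcusp : ModularParam.eichler f (.cusp ((1 / (2 * m) : ℚ) : OnePoint ℚ)) ∈ L.lattice)
    (τ : ModularParam.HStar) :
    ModularParam.xCoord W L f (ModularParam.HStar.moebius (ModularParam.wMat m) τ) =
      ModularParam.xCoord W L f τ := by
  have : NeZero (4 * m) := ⟨by positivity⟩
  refine ModularParam.xCoord_eq_of_eichler_add_mem W L ?_
  rwa [ModularParam.eichler_moebius, ModularParam.slash_wMat_eq_neg hm f hf,
    ModularParam.eichler_neg, neg_add_cancel_right, ModularParam.wMat_smul_infty m hm.ne']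

theorem lemma8p2 (N m : ℕ) (hm : 0 < m) (hN : N = 4 * m)
    (W : WeierstrassCurve ℚ) [W.IsElliptic]
    (f : CuspForm (Gamma0 N) 2) (hf : ModularParam.IsNewform f)
    (hfW : ModularParam.IsAssociated f W)
    (L : PeriodPair) (hL : ModularParam.IsPeriodLattice W L)
    (hopt : ModularParam.IsOptimal f L 1)
    (hcusp : ModularParam.eichler f (.cusp ((2 / N : ℚ) : OnePoint ℚ)) ∈ L.lattice)
    (τ : ModularParam.HStar) :
    ModularParam.xCoord W L f (ModularParam.HStar.moebius (ModularParam.wMat m) τ) =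
      ModularParam.xCoord W L f τ := by
  subst hN
  exact lemma8p2_general hm f (hf.new.peterssonInner_eq_zero (by omega) ⟨2, by ring⟩) W L
    (by convert hcusp using 4; push_cast; ring) τ
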